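/- Let $Y\subset\mathbb{R}^n$ and $Z\subset\mathbb{R}^p$ be embedded smooth submanifolds (without boundary), and let $G:\mathbb{R}^m\to Y\times Z$ be a diffeomorphism, i.e. a smooth bijection with smooth inverse. Regard $Y\times Z$ as a submanifold of $\mathbb{R}^n\times\mathbb{R}^p=\mathbb{R}^{n+p}$, and let $\nabla G(x)\in\mathbb{R}^{(n+p)\times m}$ be the Jacobian matrix of $G$ as a map into $\mathbb{R}^{n+p}$. Let $\mathrm{Vol}$ be the Riemannian volume measure on $Y\times Z$ of the metric induced by the Euclidean metric of $\mathbb{R}^{n+p}$, i.e. the measure given in every smooth chart by $\sqrt{\det g}\,du$. It exists, is unique, and equals the surface measure, i.e. the restriction to $Y\times Z$ of the $m$-dimensional Hausdorff measure of $\mathbb{R}^{n+p}$ (normalized to agree with Lebesgue measure on $\mathbb{R}^m$). Then $\det(\nabla G(x)^\top\nabla G(x))>0$ for every $x\in\mathbb{R}^m$. If $\pi_{\mathbb{R}^m}$ is a probability density on $\mathbb{R}^m$ with respect to Lebesgue measure, then $$\pi_{Y\times Z}(y,z)=\frac{\pi_{\mathbb{R}^m}(x)}{\sqrt{\det(\nabla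 G(x)^\top\nabla G(x))}},\qquad x=G^{-1}(y,z),$$ is a probability density on $Y\times Z$ with respect to $\mathrm{Vol}$, and it is the density of the push-forward under $G$: if $x$ has density $\pi_{\mathbb{R}^m}$, then $(y,z)=G(x)$ has density $\pi_{Y\times Z}$ with respect to $\mathrm{Vol}$. -/

import Mathlib

open MeasureTheory Manifold
open scoped ContDiff

noncomputable section

/-- `f` is a probability density with respect to the measure `μ`. -/
structure IsProbabilityDensity {α : Type*} [MeasurableSpace α] (μ : Measure α) (f : α → ℝ) :
    Prop where
  measurable : Measurable f
  nonneg : ∀ x, 0 ≤ f x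
  lintegral_eq_one : ∫⁻ x, ENNReal.ofReal (f x) ∂μ = 1

/-- The measure `f dμ` with density `f` with respect to `μ`. -/
def densityMeasure {α : Type*} [MeasurableSpace α] (μ : Measure α) (f : α → ℝ) : Measure α :=
  μ.withDensity fun x => ENNReal.ofReal (f x)

/-- The Jacobian matrix `(∂fᵢ/∂xⱼ)` at `x` of a map between Euclidean spaces. -/
def jacobianMatrix {a b : Type*} [Fintype a] [DecidableEq a] [Fintype b]
    (f : EuclideanSpace ℝ a → EuclideanSpace ℝ b) (x : EuclideanSpace ℝ a) : Matrix b a ℝ :=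
  Matrix.of fun i j => fderiv ℝ f x (EuclideanSpace.single j 1) i

/-- The inclusion `(y, z) ↦ (y₁, …, yₙ, z₁, …, z_p)` of `Y × Z` into `ℝⁿ⁺ᵖ` with its Euclidean
norm. -/
def prodInclusion {n p : ℕ} (Y : Set (EuclideanSpace ℝ (Fin n)))
    (Z : Set (EuclideanSpace ℝ (Fin p))) (q : Y × Z) : EuclideanSpace ℝ (Fin n ⊕ Fin p) :=
  WithLp.toLp 2 (Sum.elim (fun i => q.1.1 i) (fun j => q.2.1 j))

/-- The density `√(det (⟨∂ᵢψ(u), ∂ⱼψ(u)⟩))` at the point `u` of a domain `s ⊆ E` of the Riemannian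
volume of the metric that a parametrization `ψ : s → F` pulls back from the inner product of `F`.
The partial derivatives are taken along the basis `Module.finBasis ℝ E`, and the density is with
respect to the translation invariant measure that gives the unit box of this basis the mass one. -/
def volumeDensity {E F : Type*} [NormedAddCommGroup E] [NormedSpace ℝ E] [FiniteDimensional ℝ E]
    [NormedAddCommGroup F] [InnerProductSpace ℝ F] (s : Set E) (ψ : E → F) (u : E) : ℝ :=
  √(Matrix.gram ℝ fun i => fderivWithin ℝ ψ s u (Module.finBasis ℝ E i)).det

/-- `vol` is the Riemannian volume measure on the manifold `M` of the metric induced by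
`ι : M → F` from the inner product of `F`: in every smooth chart it is given by `√(det g) du`. -/
def IsInducedVolume {E H F M : Type*} [NormedAddCommGroup E] [NormedSpace ℝ E]
    [FiniteDimensional ℝ E] [MeasurableSpace E] [BorelSpace E] [TopologicalSpace H]
    [NormedAddCommGroup F] [InnerProductSpace ℝ F]
    [TopologicalSpace M] [ChartedSpace H M] [MeasurableSpace M]
    (I : ModelWithCorners ℝ E H) (ι : M → F) (vol : Measure M) : Prop :=
  ∀ φ ∈ IsManifold.maximalAtlas I ∞ M, ∀ A : Set M, MeasurableSet A → A ⊆ φ.source →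
    vol A = ∫⁻ u in φ.extend I '' A,
      ENNReal.ofReal (volumeDensity (Set.range I) (ι ∘ (φ.extend I).symm) u)
      ∂(Module.finBasis ℝ E).addHaar

/-- The `d`-dimensional Hausdorff measure of `ℝⁿ⁺ᵖ`, normalized to agree with Lebesgue measure on
`d`-dimensional Euclidean space, as a measure on the subset `Y × Z`. -/
def surfaceMeasure {n p : ℕ} (d : ℕ) (Y : Set (EuclideanSpace ℝ (Fin n)))
    (Z : Set (EuclideanSpace ℝ (Fin p))) : Measure (Y × Z) :=
  (μHE[d] : Measure (EuclideanSpace ℝ (Fin n ⊕ Fin p))).comap (prodInclusion Y Z)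

/-- The determinant `det (∇G(x)ᵀ ∇G(x))`, where `∇G(x)` is the `(n + p) × m` Jacobian matrix of `G`
as a map from `ℝᵐ` to `ℝⁿ⁺ᵖ`. -/
def gramDet {m n p : ℕ} {Y : Set (EuclideanSpace ℝ (Fin n))} {Z : Set (EuclideanSpace ℝ (Fin p))}
    (G : EuclideanSpace ℝ (Fin m) → Y × Z) (x : EuclideanSpace ℝ (Fin m)) : ℝ :=
  ((jacobianMatrix (prodInclusion Y Z ∘ G) x).transpose *
    jacobianMatrix (prodInclusion Y Z ∘ G) x).det

end

/-!
The heart of the matter is the area formula: if `f` is an injective `C¹` immersion of an open set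
`s` of a `d`-dimensional space, then the `d`-dimensional Hausdorff measure of `f '' A` is the
integral over `A ⊆ s` of the volume factor `√(det ⟨∂ᵢf, ∂ⱼf⟩)`. For a linear map this is known
(`LinearMap.normDet`). For a general `f`, both sides are measures of `A`, and near a point `a` the
increments of `f` and of its derivative `T` at `a` agree up to a factor `c` as close to one as
desired. Hausdorff measures of images then agree up to `c ^ d`, and so do the volume factors of `T`
and of the derivatives nearby. Hence the two measures compare locally up to `c ^ (2 * d)`, thus
globally, and `c → 1` gives `euclideanHausdorffMeasure_image_eq_lintegral_normDet`. A linear change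
of variables adapts it to an arbitrary basis of a normed space.

The formula applies to every smooth parametrization of `Y × Z`, since an immersion has a smooth
local left inverse (`Manifold.IsImmersionAt.exists_contMDiffAt_leftInverse`), so that the
parametrization followed by the inclusion has an injective derivative. Applied to the inverses of
charts, it says that the surface measure is an induced Riemannian volume. There is no other, as
`G⁻¹` is a global chart up to a linear isomorphism. Applied to `G`, it says that the surface measure
is the image under `G` of the measure with density `√(gramDet G)`, and the push-forward formula
follows by cancelling this positive factor.
-/

/-! ### Measures that compare locally -/

theorem measure_le_of_locally_le {X : Type*} [TopologicalSpace X] [SecondCountableTopology X]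
    [MeasurableSpace X] [OpensMeasurableSpace X] {μ ν : Measure X}
    (h : ∀ x, ∃ u, IsOpen u ∧ x ∈ u ∧ ∀ B ⊆ u, MeasurableSet B → μ B ≤ ν B) : μ ≤ ν := by
  choose u hu hxu hB using h
  obtain ⟨t, htc, ht⟩ := TopologicalSpace.countable_cover_nhds fun x => (hu x).mem_nhds (hxu x)
  rcases isEmpty_or_nonempty X with hX | hX
  · exact Measure.le_iff.2 fun A _ => by simp [Set.eq_empty_of_isEmpty A]
  have htn : t.Nonempty := by
    by_contra hne
    rw [Set.not_nonempty_iff_eq_empty] at hne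
    simp [hne, Set.empty_ne_univ] at ht
  obtain ⟨g, rfl⟩ := htc.exists_eq_range htn
  rw [Set.biUnion_range] at ht
  have hdm : ∀ n, MeasurableSet (disjointed (fun n => u (g n)) n) := fun n =>
    MeasurableSet.disjointed (fun i => (hu (g i)).measurableSet) n
  refine Measure.le_iff.2 fun A hA => ?_
  have hAU : A = ⋃ n, A ∩ disjointed (fun n => u (g n)) n := by
    rw [← Set.inter_iUnion, iUnion_disjointed, ht, Set.inter_univ]
  have hdisj : Pairwise (Function.onFun Disjoint
      fun n => A ∩ disjointed (fun n => u (g n)) n) := fun i j hij =>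
    (disjoint_disjointed _ hij).mono Set.inter_subset_right Set.inter_subset_right
  rw [hAU, measure_iUnion hdisj fun n => hA.inter (hdm n),
    measure_iUnion hdisj fun n => hA.inter (hdm n)]
  exact ENNReal.tsum_le_tsum fun n => hB _ _
    (Set.inter_subset_right.trans (disjointed_subset _ _)) (hA.inter (hdm n))

/-! ### Hausdorff measure of images under comparable maps -/

theorem euclideanHausdorffMeasure_image_le_of_edist_le {X F F' : Type*}
    [EMetricSpace F] [MeasurableSpace F] [BorelSpace F]
    [EMetricSpace F'] [MeasurableSpace F'] [BorelSpace F']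
    {a : X → F} {b : X → F'} {s : Set X} {c : NNReal}
    (h : ∀ x ∈ s, ∀ y ∈ s, edist (a x) (a y) ≤ c * edist (b x) (b y)) (d : ℕ) :
    μHE[d] (a '' s) ≤ (c : ENNReal) ^ d * μHE[d] (b '' s) := by
  rcases isEmpty_or_nonempty X with hX | hX
  · simp [Set.eq_empty_of_isEmpty s]
  -- `a` factors on `s` through `b` by a Lipschitz map
  have hl : LipschitzOnWith c (a ∘ Function.invFunOn b s) (b '' s) := by
    rintro p hp q hq
    have h1 := Function.invFunOn_mem hp
    have h2 := Function.invFunOn_mem hq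
    simpa [Function.invFunOn_eq hp, Function.invFunOn_eq hq] using h _ h1 _ h2
  have himg : (a ∘ Function.invFunOn b s) '' (b '' s) = a '' s := by
    rw [Set.image_image]
    refine Set.image_congr fun x hx => ?_
    have hp : b x ∈ b '' s := Set.mem_image_of_mem b hx
    have h1 := h _ (Function.invFunOn_mem hp) x hx
    rw [Function.invFunOn_eq hp, edist_self, mul_zero] at h1
    exact edist_le_zero.1 h1
  have := hl.hausdorffMeasure_image_le (d := d) (Nat.cast_nonneg d)
  rw [himg, ENNReal.rpow_natCast] at this
  simp only [Measure.euclideanHausdorffMeasure_def, Measure.smul_apply, Measure.nnreal_smul_coe_apply]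
  rw [mul_left_comm]
  gcongr

/-! ### The area formula -/

section Area

variable {U F : Type*} [NormedAddCommGroup U] [InnerProductSpace ℝ U] [FiniteDimensional ℝ U]
  [NormedAddCommGroup F] [InnerProductSpace ℝ F]

open Module

theorem edist_le_mul_edist_of_norm_sub_le {F F' : Type*} [SeminormedAddCommGroup F]
    [SeminormedAddCommGroup F'] {x y : F} {z w : F'} {c : NNReal} (h : ‖x - y‖ ≤ c * ‖z - w‖) :
    edist x y ≤ c * edist z w := by
  rw [edist_eq_enorm_sub, edist_eq_enorm_sub, ← ofReal_norm, ← ofReal_norm,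
    ← ENNReal.ofReal_coe_nnreal, ← ENNReal.ofReal_mul c.coe_nonneg]
  exact ENNReal.ofReal_le_ofReal h

/-- Linear maps that are comparable in norm have comparable volume factors, because the images of
the unit ball have comparable Hausdorff measure. -/
theorem LinearMap.normDet_le_of_norm_le (S T : U →ₗ[ℝ] F) (c : NNReal)
    (h : ∀ v, ‖S v‖ ≤ c * ‖T v‖) :
    ENNReal.ofReal S.normDet ≤ (c : ENNReal) ^ finrank ℝ U * ENNReal.ofReal T.normDet := by
  borelize U F
  have h1 : ∀ x ∈ Metric.ball (0 : U) 1, ∀ y ∈ Metric.ball (0 : U) 1,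
      edist (S x) (S y) ≤ c * edist (T x) (T y) := fun x _ y _ =>
    edist_le_mul_edist_of_norm_sub_le (by simpa using h (x - y))
  have h2 := euclideanHausdorffMeasure_image_le_of_edist_le h1 (finrank ℝ U)
  rw [S.euclideanHausdorffMeasure_image_eq_normDet_mul_volume,
    T.euclideanHausdorffMeasure_image_eq_normDet_mul_volume, ← mul_assoc] at h2
  exact (ENNReal.mul_le_mul_iff_left (Metric.measure_ball_pos _ _ one_pos).ne'
    measure_ball_lt_top.ne).1 h2

/-- The bound `1 - c⁻¹` on the relative error makes both `1 + δ * K ≤ c` and `(1 - δ * K)⁻¹ ≤ c`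
hold. -/
theorem norm_comparison_of_norm_sub_le {V : Type*} [SeminormedAddCommGroup V] {c K δ r : ℝ} {w t : V}
    (hc : 1 < c)
    (hδ : δ * K ≤ 1 - c⁻¹) (hδ0 : 0 ≤ δ) (hw : ‖w - t‖ ≤ δ * r) (ht : r ≤ K * ‖t‖) :
    ‖w‖ ≤ c * ‖t‖ ∧ ‖t‖ ≤ c * ‖w‖ := by
  have hc0 : 0 < c := by linarith
  have h1 : ‖w - t‖ ≤ (1 - c⁻¹) * ‖t‖ :=
    hw.trans (calc
      δ * r ≤ δ * (K * ‖t‖) := by gcongr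
      _ = δ * K * ‖t‖ := by ring
      _ ≤ _ := by gcongr)
  have h2 : ‖w‖ ≤ ‖t‖ + ‖w - t‖ := by simpa using norm_add_le t (w - t)
  have h3 : ‖t‖ ≤ ‖w‖ + ‖w - t‖ := by
    rw [norm_sub_rev]; simpa using norm_add_le w (t - w)
  have h4 : c * c⁻¹ = 1 := mul_inv_cancel₀ hc0.ne'
  have h5 : 0 < c⁻¹ := inv_pos.2 hc0
  constructor
  · have : (2 - c⁻¹) * ‖t‖ ≤ c * ‖t‖ := by
      gcongr
      nlinarith [mul_pos hc0 h5, sq_nonneg (c - 1)]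
    linarith
  · have : c⁻¹ * ‖t‖ ≤ ‖w‖ := by linarith
    calc ‖t‖ = c * (c⁻¹ * ‖t‖) := by rw [← mul_assoc, h4, one_mul]
      _ ≤ _ := by gcongr

/-- Near a point where the derivative `T` of a `C¹` map `f` is injective, `f` and `T` have
comparable increments, and so have `T` and the derivatives of `f` at nearby points. -/
theorem ContDiffAt.exists_nhds_norm_comparison {f : U → F} {a : U} (hf : ContDiffAt ℝ 1 f a)
    (hinj : Function.Injective (fderiv ℝ f a)) {c : ℝ} (hc : 1 < c) :
    ∃ u ∈ nhds a, (∀ x ∈ u, ∀ y ∈ u, ‖f x - f y‖ ≤ c * ‖fderiv ℝ f a x - fderiv ℝ f a y‖ ∧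
        ‖fderiv ℝ f a x - fderiv ℝ f a y‖ ≤ c * ‖f x - f y‖) ∧
      ∀ x ∈ u, ∀ v, ‖fderiv ℝ f x v‖ ≤ c * ‖fderiv ℝ f a v‖ ∧
        ‖fderiv ℝ f a v‖ ≤ c * ‖fderiv ℝ f x v‖ := by
  obtain ⟨K, hK, hT⟩ := (fderiv ℝ f a).toLinearMap.exists_antilipschitzWith
    (LinearMap.ker_eq_bot.2 hinj)
  have hTn : ∀ v, ‖v‖ ≤ K * ‖fderiv ℝ f a v‖ := fun v => by
    simpa using hT.le_mul_norm_sub v 0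
  have hη : 0 < 1 - c⁻¹ := sub_pos.2 (inv_lt_one_of_one_lt₀ hc)
  obtain ⟨δ, hδ0, hδ⟩ : ∃ δ : NNReal, 0 < δ ∧ (δ : ℝ) * K ≤ 1 - c⁻¹ :=
    ⟨(1 - c⁻¹).toNNReal / K, div_pos (Real.toNNReal_pos.2 hη) hK, by
      rw [← NNReal.coe_mul, div_mul_cancel₀ _ hK.ne', Real.coe_toNNReal _ hη.le]⟩
  obtain ⟨u, hu, hfu⟩ :=
    (hf.hasStrictFDerivAt one_ne_zero).approximates_deriv_on_nhds (c := δ) (Or.inr hδ0)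
  have hcont : ContinuousAt (fderiv ℝ f) a :=
    (hf.fderiv_right (m := 0) (by norm_num)).continuousAt
  have hball := hcont.preimage_mem_nhds (Metric.closedBall_mem_nhds (fderiv ℝ f a)
    (NNReal.coe_pos.2 hδ0))
  refine ⟨u ∩ _, Filter.inter_mem hu hball, fun x hx y hy => ?_, fun x hx v => ?_⟩
  · rw [← map_sub]
    exact norm_comparison_of_norm_sub_le hc hδ δ.coe_nonneg (hfu x hx.1 y hy.1) (hTn _)
  · refine norm_comparison_of_norm_sub_le hc hδ δ.coe_nonneg (r := ‖v‖) ?_ (hTn _)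
    rw [← sub_apply]
    refine (ContinuousLinearMap.le_opNorm _ _).trans ?_
    gcongr
    simpa [dist_eq_norm] using hx.2

variable [MeasurableSpace U] [BorelSpace U] [MeasurableSpace F] [BorelSpace F]

/-- The two measures of the area formula are locally comparable, up to a factor that is arbitrarily
close to one. -/
theorem ContDiffAt.exists_nhds_area_comparison {f : U → F} {a : U} (hf : ContDiffAt ℝ 1 f a)
    (hinj : Function.Injective (fderiv ℝ f a)) {c : NNReal} (hc : 1 < c) :
    ∃ u, IsOpen u ∧ a ∈ u ∧ ∀ B ⊆ u, MeasurableSet B →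
      μHE[finrank ℝ U] (f '' B) ≤ (c : ENNReal) ^ (2 * finrank ℝ U) *
          ∫⁻ x in B, ENNReal.ofReal (fderiv ℝ f x).toLinearMap.normDet ∧
        ∫⁻ x in B, ENNReal.ofReal (fderiv ℝ f x).toLinearMap.normDet ≤
          (c : ENNReal) ^ (2 * finrank ℝ U) * μHE[finrank ℝ U] (f '' B) := by
  obtain ⟨u, hu, h1, h2⟩ := hf.exists_nhds_norm_comparison hinj (c := c) (by exact_mod_cast hc)
  obtain ⟨w, hwu, hw, haw⟩ := mem_nhds_iff.1 hu
  refine ⟨w, hw, haw, fun B hBw hB => ?_⟩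
  set T := (fderiv ℝ f a).toLinearMap with hT
  have hBu := hBw.trans hwu
  have hvol : μHE[finrank ℝ U] (T '' B) = ∫⁻ x in B, ENNReal.ofReal T.normDet := by
    rw [T.euclideanHausdorffMeasure_image_eq_normDet_mul_volume, setLIntegral_const]
  have hcm : ∀ g : U → ENNReal, (c : ENNReal) ^ finrank ℝ U * ∫⁻ x in B, g x =
      ∫⁻ x in B, (c : ENNReal) ^ finrank ℝ U * g x := fun g =>
    (lintegral_const_mul' _ _ (ENNReal.pow_ne_top ENNReal.coe_ne_top)).symm
  rw [two_mul, pow_add, mul_assoc, mul_assoc]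
  constructor
  · refine (euclideanHausdorffMeasure_image_le_of_edist_le (a := f) (b := T) (fun x hx y hy =>
      edist_le_mul_edist_of_norm_sub_le (h1 x (hBu hx) y (hBu hy)).1) _).trans ?_
    rw [hvol, hcm fun x => ENNReal.ofReal (fderiv ℝ f x).toLinearMap.normDet]
    refine mul_le_mul' le_rfl ?_
    exact setLIntegral_mono' hB fun x hx =>
      LinearMap.normDet_le_of_norm_le _ _ _ fun v => (h2 x (hBu hx) v).2
  · refine (setLIntegral_mono' hB fun x hx =>
      LinearMap.normDet_le_of_norm_le (fderiv ℝ f x).toLinearMap T c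
        fun v => (h2 x (hBu hx) v).1).trans ?_
    rw [← hcm, ← hvol]
    gcongr
    exact euclideanHausdorffMeasure_image_le_of_edist_le (a := T) (b := f) (fun x hx y hy =>
      edist_le_mul_edist_of_norm_sub_le (h1 x (hBu hx) y (hBu hy)).2) _

theorem ENNReal.le_of_forall_one_lt_le_pow_mul {X Y : ENNReal} (d : ℕ)
    (h : ∀ c : NNReal, 1 < c → X ≤ (c : ENNReal) ^ d * Y) : X ≤ Y := by
  have h1 : Filter.Tendsto (fun c : NNReal => (c : ENNReal) ^ d * Y)
      (nhdsWithin 1 (Set.Ioi 1)) (nhds (((1 : NNReal) : ENNReal) ^ d * Y)) := by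
    refine ENNReal.Tendsto.mul_const ?_ (Or.inl (by simp))
    exact ((ENNReal.continuous_pow d).comp ENNReal.continuous_coe).continuousWithinAt
  rw [ENNReal.coe_one, one_pow, one_mul] at h1
  exact ge_of_tendsto h1 (eventually_mem_nhdsWithin.mono fun c hc => h c hc)

/-- The **area formula** for an injective `C¹` immersion of an open subset of a Euclidean space. -/
theorem euclideanHausdorffMeasure_image_eq_lintegral_normDet {f : U → F} {s A : Set U}
    (hs : IsOpen s) (hf : ContDiffOn ℝ 1 f s) (hinj : s.InjOn f)
    (hf' : ∀ x ∈ s, Function.Injective (fderiv ℝ f x)) (hA : MeasurableSet A) (hAs : A ⊆ s) :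
    μHE[finrank ℝ U] (f '' A) =
      ∫⁻ x in A, ENNReal.ofReal (fderiv ℝ f x).toLinearMap.normDet := by
  have hemb := hf.continuousOn.measurableEmbedding hs.measurableSet hinj
  set μ : Measure s := (μHE[finrank ℝ U] : Measure F).comap (s.domRestrict f)
  set ν : Measure s := (volume.withDensity fun x =>
    ENNReal.ofReal (fderiv ℝ f x).toLinearMap.normDet).comap Subtype.val
  have hval := MeasurableEmbedding.subtype_coe hs.measurableSet
  have hμ : ∀ B : Set s, μ B = μHE[finrank ℝ U] (f '' (Subtype.val '' B)) := fun B => by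
    rw [hemb.comap_apply, Set.image_image]; rfl
  have hν : ∀ B : Set s, MeasurableSet B → ν B = ∫⁻ x in Subtype.val '' B,
      ENNReal.ofReal (fderiv ℝ f x).toLinearMap.normDet := fun B hB => by
    rw [hval.comap_apply, withDensity_apply _ (hval.measurableSet_image.2 hB)]
  have key : ∀ c : NNReal, 1 < c → μ ≤ (c : ENNReal) ^ (2 * finrank ℝ U) • ν ∧
      ν ≤ (c : ENNReal) ^ (2 * finrank ℝ U) • μ := by
    intro c hc
    constructor <;>
    · refine measure_le_of_locally_le fun x => ?_
      obtain ⟨u, hu, hxu, h⟩ := (hf.contDiffAt (hs.mem_nhds x.2)).exists_nhds_area_comparison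
        (hf' x x.2) hc
      refine ⟨Subtype.val ⁻¹' u, hu.preimage continuous_subtype_val, hxu, fun B hBu hB => ?_⟩
      rw [Measure.smul_apply, smul_eq_mul, hμ, hν B hB]
      first
      | exact (h _ (Set.image_subset_iff.2 hBu) (hval.measurableSet_image.2 hB)).1
      | exact (h _ (Set.image_subset_iff.2 hBu) (hval.measurableSet_image.2 hB)).2
  have hAim : Subtype.val '' (Subtype.val ⁻¹' A : Set s) = A := by
    rw [Subtype.image_preimage_coe, Set.inter_eq_right.2 hAs]
  have hAm : MeasurableSet (Subtype.val ⁻¹' A : Set s) := measurable_subtype_coe hA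
  have h1 := hμ (Subtype.val ⁻¹' A)
  have h2 := hν _ hAm
  rw [hAim] at h1 h2
  rw [← h1, ← h2]
  exact le_antisymm (ENNReal.le_of_forall_one_lt_le_pow_mul _ fun c hc => (key c hc).1 _)
    (ENNReal.le_of_forall_one_lt_le_pow_mul _ fun c hc => (key c hc).2 _)

end Area

theorem LinearMap.normDet_eq_sqrt_det_gram {ι U F : Type*} [Fintype ι] [DecidableEq ι]
    [NormedAddCommGroup U] [InnerProductSpace ℝ U] [FiniteDimensional ℝ U]
    [NormedAddCommGroup F] [InnerProductSpace ℝ F] (T : U →ₗ[ℝ] F) (b : OrthonormalBasis ι ℝ U) :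
    T.normDet = √(Matrix.gram ℝ fun i => T (b i)).det := by
  rw [← T.normDet_sq_eq_det_gram b]
  exact (Real.sqrt_sq T.normDet_nonneg).symm

/-- The **area formula** in a normed space without inner product: the volume factor is the square
root of the Gram determinant of the derivatives along a basis, with respect to the Haar measure of
this basis. -/
theorem euclideanHausdorffMeasure_image_eq_lintegral_sqrt_det_gram {ι E F : Type*} [Fintype ι]
    [DecidableEq ι] [NormedAddCommGroup E] [NormedSpace ℝ E] [FiniteDimensional ℝ E]
    [MeasurableSpace E] [BorelSpace E] [NormedAddCommGroup F] [InnerProductSpace ℝ F]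
    [MeasurableSpace F] [BorelSpace F] (b : Module.Basis ι ℝ E) {f : E → F} {s A : Set E}
    (hs : IsOpen s) (hf : ContDiffOn ℝ 1 f s) (hinj : s.InjOn f)
    (hf' : ∀ x ∈ s, Function.Injective (fderiv ℝ f x)) (hA : MeasurableSet A) (hAs : A ⊆ s) :
    μHE[Module.finrank ℝ E] (f '' A) =
      ∫⁻ x in A, ENNReal.ofReal √(Matrix.gram ℝ fun i => fderiv ℝ f x (b i)).det ∂b.addHaar := by
  set o := EuclideanSpace.basisFun ι ℝ
  set L : EuclideanSpace ℝ ι ≃L[ℝ] E :=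
    (o.toBasis.equiv b (Equiv.refl ι)).toContinuousLinearEquiv
  have hLo : ∀ i, L (o i) = b i := fun i => by
    have h := o.toBasis.equiv_apply i b (Equiv.refl ι)
    rwa [o.coe_toBasis] at h
  have hLb : o.toBasis.map (L : EuclideanSpace ℝ ι ≃ₗ[ℝ] E) = b :=
    Module.Basis.eq_of_apply_eq fun i => by simpa using hLo i
  have hmp : MeasurePreserving L volume b.addHaar :=
    ⟨L.continuous.measurable, by rw [← o.addHaar_eq_volume, o.toBasis.map_addHaar L, hLb]⟩
  have hd : ∀ x, fderiv ℝ (f ∘ L) x =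
      (fderiv ℝ f (L x)).comp (L : EuclideanSpace ℝ ι →L[ℝ] E) := fun x =>
    L.comp_right_fderiv
  have harea := euclideanHausdorffMeasure_image_eq_lintegral_normDet (f := f ∘ L)
    (hs.preimage L.continuous) (hf.comp L.contDiff.contDiffOn fun x hx => hx)
    (fun x hx y hy h => L.injective (hinj hx hy h))
    (fun x hx => by
      rw [hd]
      exact (hf' _ hx).comp L.injective)
    (L.continuous.measurable hA) (Set.preimage_mono hAs)
  rw [Set.image_comp, Set.image_preimage_eq _ L.surjective, L.toLinearEquiv.finrank_eq] at harea
  rw [harea, ← hmp.setLIntegral_comp_preimage_emb L.toHomeomorph.measurableEmbedding]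
  refine lintegral_congr fun x => ?_
  rw [LinearMap.normDet_eq_sqrt_det_gram _ o, hd]
  simp only [ContinuousLinearMap.coe_coe, ContinuousLinearMap.comp_apply,
    ContinuousLinearEquiv.coe_coe, hLo]

/-! ### Immersions have smooth local left inverses -/

/-- In the charts of an immersion, the projection to the first factor is a left inverse. -/
theorem Manifold.IsImmersionAt.exists_contMDiffAt_leftInverse
    {E E' H H' M N : Type*} [NormedAddCommGroup E] [NormedSpace ℝ E]
    [NormedAddCommGroup E'] [NormedSpace ℝ E'] [TopologicalSpace H] [TopologicalSpace H']
    {I : ModelWithCorners ℝ E H} {J : ModelWithCorners ℝ E' H'} [I.Boundaryless]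
    [TopologicalSpace M] [ChartedSpace H M] [TopologicalSpace N] [ChartedSpace H' N]
    {n : WithTop ℕ∞} {f : M → N} {x : M} (h : IsImmersionAt I J n f x) :
    ∃ r : N → M, ContMDiffAt J I n r (f x) ∧ ∀ᶠ y in nhds x, r (f y) = y := by
  set φ := h.domChart
  set ψ := h.codChart
  let pr : E' →L[ℝ] E :=
    (ContinuousLinearMap.fst ℝ E h.complement).comp (h.equiv.symm : E' →L[ℝ] E × h.complement)
  have hpr : ∀ y ∈ φ.source, pr (ψ.extend J (f y)) = φ.extend I y := fun y hy => by
    have hy' : φ.extend I y ∈ (φ.extend I).target :=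
      (φ.extend I).map_source (by rwa [φ.extend_source])
    have h1 := h.writtenInCharts hy'
    simp only [Function.comp_apply] at h1
    rw [φ.extend_left_inv hy] at h1
    change (h.equiv.symm (ψ.extend J (f y))).1 = _
    rw [h1, ContinuousLinearEquiv.symm_apply_apply]
  refine ⟨fun q => (φ.extend I).symm (pr (ψ.extend J q)), ?_, ?_⟩
  · have h1 : ContMDiffAt J 𝓘(ℝ, E') n (ψ.extend J) (f x) :=
      ψ.contMDiffAt_extend h.codChart_mem_maximalAtlas h.mem_codChart_source
    have h2 : ContMDiffAt J 𝓘(ℝ, E) n (fun q => pr (ψ.extend J q)) (f x) :=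
      pr.contMDiff.contMDiffAt.comp (f x) h1
    have h3 := contMDiffOn_extend_symm (I := I) h.domChart_mem_maximalAtlas
    rw [← φ.extend_target'] at h3
    refine (h3.contMDiffAt ?_).comp (f x) h2
    rw [hpr x h.mem_domChart_source]
    exact φ.isOpen_extend_target.mem_nhds
      ((φ.extend I).map_source (by rw [φ.extend_source]; exact h.mem_domChart_source))
  · filter_upwards [φ.open_source.mem_nhds h.mem_domChart_source] with y hy
    rw [hpr y hy, φ.extend_left_inv hy]

/-! ### The inclusion of the product -/

/-- The linear isomorphism `(a, b) ↦ (a₁, …, aₙ, b₁, …, b_p)` that underlies `prodInclusion`. -/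
noncomputable def euclideanProdEquiv (n p : ℕ) :
    (EuclideanSpace ℝ (Fin n) × EuclideanSpace ℝ (Fin p)) ≃L[ℝ]
      EuclideanSpace ℝ (Fin n ⊕ Fin p) :=
  LinearEquiv.toContinuousLinearEquiv
    { toFun := fun q => WithLp.toLp 2 (Sum.elim (fun i => q.1 i) (fun j => q.2 j))
      invFun := fun v =>
        (WithLp.toLp 2 fun i => v (Sum.inl i), WithLp.toLp 2 fun j => v (Sum.inr j))
      map_add' := fun q q' => by ext (i | j) <;> rfl
      map_smul' := fun c q => by ext (i | j) <;> rfl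
      left_inv := fun q => rfl
      right_inv := fun v => by ext (i | j) <;> rfl }

section ProdInclusion

variable {n p k l : ℕ} {Y : Set (EuclideanSpace ℝ (Fin n))} {Z : Set (EuclideanSpace ℝ (Fin p))}

theorem prodInclusion_eq (q : Y × Z) :
    prodInclusion Y Z q = euclideanProdEquiv n p (q.1.1, q.2.1) := rfl

theorem prodInclusion_injective : Function.Injective (prodInclusion Y Z) := fun q q' h => by
  simpa [prodInclusion_eq, Prod.ext_iff, Subtype.ext_iff] using h

variable [ChartedSpace (EuclideanSpace ℝ (Fin k)) Y] [ChartedSpace (EuclideanSpace ℝ (Fin l)) Z]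

theorem contMDiff_prodInclusion
    (hY : IsSmoothEmbedding (𝓡 k) (𝓡 n) ∞ (Subtype.val : Y → EuclideanSpace ℝ (Fin n)))
    (hZ : IsSmoothEmbedding (𝓡 l) (𝓡 p) ∞ (Subtype.val : Z → EuclideanSpace ℝ (Fin p))) :
    ContMDiff ((𝓡 k).prod (𝓡 l)) 𝓘(ℝ, EuclideanSpace ℝ (Fin n ⊕ Fin p)) ∞
      (prodInclusion Y Z) :=
  (euclideanProdEquiv n p).contDiff.contMDiff.comp
    ((hY.contMDiff.comp contMDiff_fst).prodMk_space (hZ.contMDiff.comp contMDiff_snd))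

theorem exists_contMDiffAt_leftInverse_prodInclusion
    (hY : IsSmoothEmbedding (𝓡 k) (𝓡 n) ∞ (Subtype.val : Y → EuclideanSpace ℝ (Fin n)))
    (hZ : IsSmoothEmbedding (𝓡 l) (𝓡 p) ∞ (Subtype.val : Z → EuclideanSpace ℝ (Fin p)))
    (q : Y × Z) :
    ∃ r : EuclideanSpace ℝ (Fin n ⊕ Fin p) → Y × Z,
      ContMDiffAt 𝓘(ℝ, EuclideanSpace ℝ (Fin n ⊕ Fin p)) ((𝓡 k).prod (𝓡 l)) ∞ r
        (prodInclusion Y Z q) ∧ ∀ᶠ q' in nhds q, r (prodInclusion Y Z q') = q' := by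
  obtain ⟨rY, hrY, hY'⟩ := (hY.isImmersion.isImmersionAt q.1).exists_contMDiffAt_leftInverse
  obtain ⟨rZ, hrZ, hZ'⟩ := (hZ.isImmersion.isImmersionAt q.2).exists_contMDiffAt_leftInverse
  let e := (euclideanProdEquiv n p).symm
  refine ⟨fun v => (rY (e v).1, rZ (e v).2), ?_, ?_⟩
  · have h1 := e.contDiff (n := ∞)
    exact (ContMDiffAt.comp (prodInclusion Y Z q) (g := rY) hrY
      (contDiff_fst.comp h1).contMDiff.contMDiffAt).prodMk
      (ContMDiffAt.comp (prodInclusion Y Z q) (g := rZ) hrZ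
        (contDiff_snd.comp h1).contMDiff.contMDiffAt)
  · filter_upwards [continuous_fst.continuousAt.eventually hY',
      continuous_snd.continuousAt.eventually hZ'] with q' h1 h2
    exact Prod.ext h1 h2

/-- A smooth parametrization of `Y × Z` with a smooth inverse is an immersion into the ambient
space, because it has a smooth left inverse there. -/
theorem injective_fderiv_prodInclusion_comp {E : Type*} [NormedAddCommGroup E] [NormedSpace ℝ E]
    (hY : IsSmoothEmbedding (𝓡 k) (𝓡 n) ∞ (Subtype.val : Y → EuclideanSpace ℝ (Fin n)))
    (hZ : IsSmoothEmbedding (𝓡 l) (𝓡 p) ∞ (Subtype.val : Z → EuclideanSpace ℝ (Fin p)))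
    {g : E → Y × Z} {h : Y × Z → E} {u : E}
    (hg : ContMDiffAt 𝓘(ℝ, E) ((𝓡 k).prod (𝓡 l)) ∞ g u)
    (hh : ContMDiffAt ((𝓡 k).prod (𝓡 l)) 𝓘(ℝ, E) ∞ h (g u))
    (hgh : ∀ᶠ v in nhds u, h (g v) = v) :
    Function.Injective (fderiv ℝ (prodInclusion Y Z ∘ g) u) := by
  obtain ⟨r, hr, hr'⟩ := exists_contMDiffAt_leftInverse_prodInclusion hY hZ (g u)
  have hψ : DifferentiableAt ℝ (prodInclusion Y Z ∘ g) u :=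
    ((contMDiff_prodInclusion hY hZ).contMDiffAt.comp u hg).contDiffAt.differentiableAt (by simp)
  have hR : DifferentiableAt ℝ (h ∘ r) ((prodInclusion Y Z ∘ g) u) := by
    refine ContDiffAt.differentiableAt (n := ∞) (ContMDiffAt.contDiffAt ?_) (by simp)
    refine ContMDiffAt.comp _ ?_ hr
    rwa [Function.comp_apply, hr'.self_of_nhds]
  have hid : (h ∘ r) ∘ (prodInclusion Y Z ∘ g) =ᶠ[nhds u] id := by
    filter_upwards [hgh, hg.continuousAt.eventually hr'] with v h1 h2
    simp only [Function.comp_apply, id_eq]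
    rw [h2, h1]
  have hcomp := fderiv_comp u hR hψ
  rw [hid.fderiv_eq, fderiv_id] at hcomp
  exact Function.LeftInverse.injective fun v => (DFunLike.congr_fun hcomp v).symm

end ProdInclusion

section SurfaceMeasure

variable {m n p k l : ℕ} {Y : Set (EuclideanSpace ℝ (Fin n))} {Z : Set (EuclideanSpace ℝ (Fin p))}
  [ChartedSpace (EuclideanSpace ℝ (Fin k)) Y] [ChartedSpace (EuclideanSpace ℝ (Fin l)) Z]

/-! ### The surface measure is the induced Riemannian volume -/

/-- The inclusion is a measurable embedding by the Lusin–Souslin theorem, as `Y × Z` is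
homeomorphic to the Polish space `ℝᵐ`. -/
theorem measurableEmbedding_prodInclusion
    (G : Diffeomorph (𝓡 m) ((𝓡 k).prod (𝓡 l)) (EuclideanSpace ℝ (Fin m)) (Y × Z) ∞)
    (hι : Continuous (prodInclusion Y Z)) : MeasurableEmbedding (prodInclusion Y Z) := by
  have h := ((hι.comp G.continuous).measurableEmbedding
    (prodInclusion_injective.comp G.injective)).comp G.symm.toHomeomorph.measurableEmbedding
  convert h using 1
  ext1 q
  simp

theorem finrank_prod_eq_of_diffeomorph
    (G : Diffeomorph (𝓡 m) ((𝓡 k).prod (𝓡 l)) (EuclideanSpace ℝ (Fin m)) (Y × Z) ∞) :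
    Module.finrank ℝ (EuclideanSpace ℝ (Fin k) × EuclideanSpace ℝ (Fin l)) = m := by
  have h : EuclideanSpace ℝ (Fin m) ≃L[ℝ] EuclideanSpace ℝ (Fin k) × EuclideanSpace ℝ (Fin l) :=
    G.mfderivToContinuousLinearEquiv (by simp) 0
  rw [← h.toLinearEquiv.finrank_eq, finrank_euclideanSpace_fin]

/-- The area formula for the surface measure, in a smooth parametrization `g` of `Y × Z` with
inverse `h`. -/
theorem surfaceMeasure_image_eq_lintegral {ι E : Type*} [Fintype ι] [DecidableEq ι]
    [NormedAddCommGroup E] [NormedSpace ℝ E] [FiniteDimensional ℝ E] [MeasurableSpace E]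
    [BorelSpace E]
    (hY : IsSmoothEmbedding (𝓡 k) (𝓡 n) ∞ (Subtype.val : Y → EuclideanSpace ℝ (Fin n)))
    (hZ : IsSmoothEmbedding (𝓡 l) (𝓡 p) ∞ (Subtype.val : Z → EuclideanSpace ℝ (Fin p)))
    (hι : MeasurableEmbedding (prodInclusion Y Z)) (b : Module.Basis ι ℝ E)
    {g : E → Y × Z} {h : Y × Z → E} {s A : Set E} (hs : IsOpen s)
    (hg : ContMDiffOn 𝓘(ℝ, E) ((𝓡 k).prod (𝓡 l)) ∞ g s)
    (hh : ∀ u ∈ s, ContMDiffAt ((𝓡 k).prod (𝓡 l)) 𝓘(ℝ, E) ∞ h (g u))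
    (hgh : ∀ u ∈ s, h (g u) = u) (hA : MeasurableSet A) (hAs : A ⊆ s) :
    surfaceMeasure (Module.finrank ℝ E) Y Z (g '' A) = ∫⁻ u in A,
      ENNReal.ofReal √(Matrix.gram ℝ fun i =>
        fderiv ℝ (prodInclusion Y Z ∘ g) u (b i)).det ∂b.addHaar := by
  have hsm : ContDiffOn ℝ ∞ (prodInclusion Y Z ∘ g) s :=
    ((contMDiff_prodInclusion hY hZ).comp_contMDiffOn hg).contDiffOn
  rw [surfaceMeasure, hι.comap_apply, ← Set.image_comp]
  refine euclideanHausdorffMeasure_image_eq_lintegral_sqrt_det_gram b hs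
    (hsm.of_le (by exact_mod_cast le_top)) ?_ (fun u hu => ?_) hA hAs
  · exact fun u hu v hv huv => by
      rw [← hgh u hu, ← hgh v hv, prodInclusion_injective huv]
  · exact injective_fderiv_prodInclusion_comp hY hZ (hg.contMDiffAt (hs.mem_nhds hu)) (hh u hu)
      (Filter.mem_of_superset (hs.mem_nhds hu) hgh)

theorem isInducedVolume_surfaceMeasure
    (hY : IsSmoothEmbedding (𝓡 k) (𝓡 n) ∞ (Subtype.val : Y → EuclideanSpace ℝ (Fin n)))
    (hZ : IsSmoothEmbedding (𝓡 l) (𝓡 p) ∞ (Subtype.val : Z → EuclideanSpace ℝ (Fin p)))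
    (hι : MeasurableEmbedding (prodInclusion Y Z)) :
    IsInducedVolume ((𝓡 k).prod (𝓡 l)) (prodInclusion Y Z)
      (surfaceMeasure
        (Module.finrank ℝ (EuclideanSpace ℝ (Fin k) × EuclideanSpace ℝ (Fin l))) Y Z) := by
  intro φ hφ A hA hAφ
  set I := (𝓡 k).prod (𝓡 l)
  have hs : IsOpen (φ.extend I).target := φ.isOpen_extend_target
  have hsymm := contMDiffOn_extend_symm hφ
  rw [← φ.extend_target'] at hsymm
  have hmaps : φ.extend I '' A ⊆ (φ.extend I).target := by
    rintro _ ⟨q, hq, rfl⟩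
    exact (φ.extend I).map_source (by rw [φ.extend_source]; exact hAφ hq)
  have hinv : (φ.extend I).symm '' (φ.extend I '' A) = A :=
    (φ.extend I).symm_image_image_of_subset_source (by rwa [φ.extend_source])
  have himg : φ.extend I '' A = Subtype.val ''
      ((φ.extend I).target.domRestrict (φ.extend I).symm ⁻¹' A) := by
    ext u
    constructor
    · rintro ⟨q, hq, rfl⟩
      refine ⟨⟨_, hmaps ⟨q, hq, rfl⟩⟩, ?_, rfl⟩
      change (φ.extend I).symm (φ.extend I q) ∈ A
      rwa [φ.extend_left_inv (hAφ hq)]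
    · rintro ⟨v, hv, rfl⟩
      exact ⟨_, hv, (φ.extend I).right_inv v.2⟩
  have hmeas : MeasurableSet (φ.extend I '' A) := by
    rw [himg]
    exact (MeasurableEmbedding.subtype_coe hs.measurableSet).measurableSet_image.2
      (hsymm.continuousOn.domRestrict.measurable hA)
  have h := surfaceMeasure_image_eq_lintegral hY hZ hι (Module.finBasis ℝ _) (h := φ.extend I) hs
    hsymm (fun u hu => φ.contMDiffAt_extend hφ ?_) (fun u hu => (φ.extend I).right_inv hu) hmeas
    hmaps
  · rw [hinv] at h
    rw [h]
    simp only [volumeDensity, I.range_eq_univ, fderivWithin_univ]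
  · rw [← φ.extend_source (I := I)]
    exact (φ.extend I).map_target hu

/-- The chart `G⁻¹`, composed with a linear isomorphism, is global, and so it determines the induced
volume. -/
theorem IsInducedVolume.eq [IsManifold (𝓡 k) ∞ Y] [IsManifold (𝓡 l) ∞ Z]
    (G : Diffeomorph (𝓡 m) ((𝓡 k).prod (𝓡 l)) (EuclideanSpace ℝ (Fin m)) (Y × Z) ∞)
    {μ ν : Measure (Y × Z)}
    (hμ : IsInducedVolume ((𝓡 k).prod (𝓡 l)) (prodInclusion Y Z) μ)
    (hν : IsInducedVolume ((𝓡 k).prod (𝓡 l)) (prodInclusion Y Z) ν) : μ = ν := by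
  let L : EuclideanSpace ℝ (Fin m) ≃L[ℝ] EuclideanSpace ℝ (Fin k) × EuclideanSpace ℝ (Fin l) :=
    ContinuousLinearEquiv.ofFinrankEq (by
      rw [finrank_prod_eq_of_diffeomorph G, finrank_euclideanSpace_fin])
  let I := (𝓡 k).prod (𝓡 l)
  let φ : OpenPartialHomeomorph (Y × Z)
      (ModelProd (EuclideanSpace ℝ (Fin k)) (EuclideanSpace ℝ (Fin l))) :=
    (G.symm.toHomeomorph.trans L.toHomeomorph).toOpenPartialHomeomorph
  have hφ : φ ∈ IsManifold.maximalAtlas I ∞ (Y × Z) := by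
    refine φ.mem_maximalAtlas_of_contMDiffOn ?_ ?_
    · have h : ContMDiffOn 𝓘(ℝ, EuclideanSpace ℝ (Fin k) × EuclideanSpace ℝ (Fin l)) I ∞ I.symm
          (Set.range I) := I.contMDiffOn_symm
      rw [I.range_eq_univ, contMDiffOn_univ] at h
      exact (h.comp (L.contDiff.contMDiff.comp G.symm.contMDiff)).contMDiffOn
    · have h : ContMDiff I 𝓘(ℝ, EuclideanSpace ℝ (Fin k) × EuclideanSpace ℝ (Fin l)) ∞ I :=
        I.contMDiff
      exact (G.contMDiff.comp (L.symm.contDiff.contMDiff.comp h)).contMDiffOn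
  ext A hA
  rw [hμ φ hφ A hA (Set.subset_univ A), hν φ hφ A hA (Set.subset_univ A)]

/-! ### The surface measure in the parametrization -/

theorem gramDet_eq_det_gram
    (G : EuclideanSpace ℝ (Fin m) → Y × Z) (x : EuclideanSpace ℝ (Fin m)) :
    gramDet G x = (Matrix.gram ℝ fun i => fderiv ℝ (prodInclusion Y Z ∘ G) x
      ((EuclideanSpace.basisFun (Fin m) ℝ).toBasis i)).det := by
  rw [gramDet]
  congr 1
  ext i j
  simp [Matrix.mul_apply, jacobianMatrix, Matrix.gram_apply, PiLp.inner_apply, mul_comm]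

theorem gramDet_pos
    (hY : IsSmoothEmbedding (𝓡 k) (𝓡 n) ∞ (Subtype.val : Y → EuclideanSpace ℝ (Fin n)))
    (hZ : IsSmoothEmbedding (𝓡 l) (𝓡 p) ∞ (Subtype.val : Z → EuclideanSpace ℝ (Fin p)))
    (G : Diffeomorph (𝓡 m) ((𝓡 k).prod (𝓡 l)) (EuclideanSpace ℝ (Fin m)) (Y × Z) ∞)
    (x : EuclideanSpace ℝ (Fin m)) : 0 < gramDet G x := by
  rw [gramDet_eq_det_gram]
  refine Matrix.PosDef.det_pos (Matrix.posDef_gram_of_linearIndependent ?_)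
  exact ((EuclideanSpace.basisFun (Fin m) ℝ).toBasis.linearIndependent).map'
    (fderiv ℝ (prodInclusion Y Z ∘ G) x).toLinearMap
    (LinearMap.ker_eq_bot.2 (injective_fderiv_prodInclusion_comp hY hZ G.contMDiff.contMDiffAt
      G.symm.contMDiff.contMDiffAt (Filter.Eventually.of_forall G.symm_apply_apply)))

theorem continuous_gramDet
    (hY : IsSmoothEmbedding (𝓡 k) (𝓡 n) ∞ (Subtype.val : Y → EuclideanSpace ℝ (Fin n)))
    (hZ : IsSmoothEmbedding (𝓡 l) (𝓡 p) ∞ (Subtype.val : Z → EuclideanSpace ℝ (Fin p)))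
    (G : Diffeomorph (𝓡 m) ((𝓡 k).prod (𝓡 l)) (EuclideanSpace ℝ (Fin m)) (Y × Z) ∞) :
    Continuous (gramDet G) := by
  have h : Continuous (fderiv ℝ (prodInclusion Y Z ∘ G)) :=
    ((contMDiff_prodInclusion hY hZ).comp G.contMDiff).contDiff.continuous_fderiv (by simp)
  have hJ : Continuous (jacobianMatrix (prodInclusion Y Z ∘ G)) :=
    continuous_matrix fun i j => by
      simp only [jacobianMatrix, Matrix.of_apply]
      fun_prop
  exact (hJ.matrix_transpose.matrix_mul hJ).matrix_det

theorem surfaceMeasure_eq_map_withDensity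
    (hY : IsSmoothEmbedding (𝓡 k) (𝓡 n) ∞ (Subtype.val : Y → EuclideanSpace ℝ (Fin n)))
    (hZ : IsSmoothEmbedding (𝓡 l) (𝓡 p) ∞ (Subtype.val : Z → EuclideanSpace ℝ (Fin p)))
    (G : Diffeomorph (𝓡 m) ((𝓡 k).prod (𝓡 l)) (EuclideanSpace ℝ (Fin m)) (Y × Z) ∞) :
    surfaceMeasure m Y Z =
      (volume.withDensity fun x => ENNReal.ofReal √(gramDet G x)).map G := by
  have hι := measurableEmbedding_prodInclusion G (contMDiff_prodInclusion hY hZ).continuous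
  have hG : Measurable G := G.continuous.measurable
  ext A hA
  have h := surfaceMeasure_image_eq_lintegral hY hZ hι
    (EuclideanSpace.basisFun (Fin m) ℝ).toBasis (g := G) (h := G.symm) (A := G ⁻¹' A) isOpen_univ
    G.contMDiff.contMDiffOn (fun u _ => G.symm.contMDiff.contMDiffAt)
    (fun u _ => G.symm_apply_apply u) (hG hA) (Set.subset_univ _)
  have himg : G '' (G ⁻¹' A) = A := Set.image_preimage_eq A G.surjective
  rw [himg, finrank_euclideanSpace_fin,
    OrthonormalBasis.addHaar_eq_volume] at h
  rw [Measure.map_apply hG hA, withDensity_apply _ (hG hA), h]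
  simp only [gramDet_eq_det_gram]

theorem map_densityMeasure_eq
    (hY : IsSmoothEmbedding (𝓡 k) (𝓡 n) ∞ (Subtype.val : Y → EuclideanSpace ℝ (Fin n)))
    (hZ : IsSmoothEmbedding (𝓡 l) (𝓡 p) ∞ (Subtype.val : Z → EuclideanSpace ℝ (Fin p)))
    (G : Diffeomorph (𝓡 m) ((𝓡 k).prod (𝓡 l)) (EuclideanSpace ℝ (Fin m)) (Y × Z) ∞)
    (π : EuclideanSpace ℝ (Fin m) → ℝ) :
    (densityMeasure volume π).map G =
      densityMeasure (surfaceMeasure m Y Z) (fun q => π (G.symm q) / √(gramDet G (G.symm q))) := by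
  have hG : MeasurableEmbedding G := G.toHomeomorph.measurableEmbedding
  have hρ : Measurable fun x => ENNReal.ofReal √(gramDet G x) :=
    (continuous_gramDet hY hZ G).sqrt.measurable.ennreal_ofReal
  ext A hA
  rw [densityMeasure, densityMeasure, surfaceMeasure_eq_map_withDensity hY hZ G,
    hG.map_apply, withDensity_apply _ (hG.measurable hA), withDensity_apply _ hA,
    hG.restrict_map, hG.lintegral_map, restrict_withDensity (hG.measurable hA),
    lintegral_withDensity_eq_lintegral_mul_non_measurable _ hρ (by simp)]
  refine lintegral_congr fun x => ?_
  have hpos := Real.sqrt_pos.2 (gramDet_pos hY hZ G x)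
  rw [Pi.mul_apply, G.symm_apply_apply, ← ENNReal.ofReal_mul hpos.le, mul_div_cancel₀ _ hpos.ne']

end SurfaceMeasure

theorem theorem1 {m n p k l : ℕ}
    (Y : Set (EuclideanSpace ℝ (Fin n))) (Z : Set (EuclideanSpace ℝ (Fin p)))
    [ChartedSpace (EuclideanSpace ℝ (Fin k)) Y] [IsManifold (𝓡 k) ∞ Y]
    [ChartedSpace (EuclideanSpace ℝ (Fin l)) Z] [IsManifold (𝓡 l) ∞ Z]
    (hY : IsSmoothEmbedding (𝓡 k) (𝓡 n) ∞ (Subtype.val : Y → EuclideanSpace ℝ (Fin n)))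
    (hZ : IsSmoothEmbedding (𝓡 l) (𝓡 p) ∞ (Subtype.val : Z → EuclideanSpace ℝ (Fin p)))
    (G : Diffeomorph (𝓡 m) ((𝓡 k).prod (𝓡 l)) (EuclideanSpace ℝ (Fin m)) (Y × Z) ∞)
    (π : EuclideanSpace ℝ (Fin m) → ℝ) (hπ : IsProbabilityDensity volume π) :
    -- the Hausdorff measure is the unique induced Riemannian volume of `Y × Z`
    (∀ vol : Measure (Y × Z),
      IsInducedVolume ((𝓡 k).prod (𝓡 l)) (prodInclusion Y Z) vol ↔ vol = surfaceMeasure m Y Z) ∧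
    -- the quotient below has a positive denominator
    (∀ x, 0 < gramDet G x) ∧
    -- the quotient is a probability density with respect to this volume
    IsProbabilityDensity (surfaceMeasure m Y Z)
      (fun q => π (G.symm q) / √(gramDet G (G.symm q))) ∧
    -- it is the density of the law of `G x` when `x` has the density `π`
    (densityMeasure volume π).map G =
      densityMeasure (surfaceMeasure m Y Z) (fun q => π (G.symm q) / √(gramDet G (G.symm q))) := by
  have hι := measurableEmbedding_prodInclusion G (contMDiff_prodInclusion hY hZ).continuous
  have hsurf := isInducedVolume_surfaceMeasure hY hZ hι
  rw [finrank_prod_eq_of_diffeomorph G] at hsurf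
  have hmap := map_densityMeasure_eq hY hZ G π
  refine ⟨fun vol => ⟨fun h => h.eq G hsurf, fun h => h ▸ hsurf⟩, gramDet_pos hY hZ G, ?_, hmap⟩
  refine ⟨?_, fun q => div_nonneg (hπ.nonneg _) (Real.sqrt_nonneg _), ?_⟩
  · have hsymm : Measurable G.symm := G.symm.continuous.measurable
    exact (hπ.measurable.comp hsymm).div
      ((continuous_gramDet hY hZ G).sqrt.measurable.comp hsymm)
  · have h := congr($hmap Set.univ)
    rw [Measure.map_apply G.continuous.measurable .univ, Set.preimage_univ, densityMeasure,
      densityMeasure, withDensity_apply _ .univ, withDensity_apply _ .univ, Measure.restrict_univ,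
      Measure.restrict_univ, hπ.lintegral_eq_one] at h
    exact h.symm
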